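/- Let $n\ge 1$ be an integer and let $\delta=\sqrt{(n+2)/n}$ or $\delta=-\sqrt{(n+2)/n}$. Let $C_k=C_k^{(3/2)}$ denote the Gegenbauer polynomials for the weight $1-x^2$ (with $C_{-1}=0$), and put $$R_n(x)=C_n(x)+\delta\,C_{n-1}(x),\qquad S_n(x)=(2n+1+\delta n x)\,C_{n-1}(x)-(n+1)\,x\,C_{n-2}(x),\qquad A=2(n+1)(2n+1).$$ Then: 1. $R_n$ has degree $n$ and exactly $n$ distinct real roots $x_1,\dots,x_n$, all of them in $(-1,1)$. 2. $R_n'(x_i)S_n(x_i)\neq 0$ for every $i$, so that the weights $w_i=\dfrac{A}{R_n'(x_i)\,S_n(x_i)}$ are well defined. 3. The rule with nodes $x_i$ and weights $w_i$, repeated on every interval, is exact for $C^0$ splines of degree $2n$ on the real line: for all real $a$ and $h>0$ and every integrable continuous function $f:\mathbb R\to\mathbb R$ that coincides on each interval $[a+kh,a+(k+1)h]$, $k\in\mathbb Z$, with a polynomial of degree at most $2n$, $$\int_{\mathbb R} f(x)\,dx=\sum_{k\in\mathbb Z}\sum_{i=1}^n \frac h2\,w_i\, f\!\Big(a+kh+\frac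 h2(1+x_i)\Big),$$ where the sum over all pairs $(k,i)$ converges absolutely. 4. The rule has no reflection symmetry: the set $\{(x_i,w_i)\}$ of its pairs (node, weight) is not invariant under $(x,w)\mapsto(-x,w)$; and, for all real $a$ and $h>0$, the set of pairs (node, weight) of the repeated rule is not invariant under $(x,w)\mapsto(c-x,w)$ for any real $c$ such that $x\mapsto c-x$ maps the set of break points $\{a+kh : k\in\mathbb Z\}$ onto itself. 5. The two signs of $\delta$ give mirror-image rules: replacing $\delta$ by $-\delta$ replaces the set $\{(x_i,w_i)\}$ by $\{(-x_i,w_i)\}$. -/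

import Mathlib

noncomputable section

open Polynomial

namespace SplineQuadrature

/-- The Gegenbauer polynomials `C_n^{(lam)}`, given by their three-term recurrence
`(n + 2) C_{n+2} = 2 (n + 1 + lam) x C_{n+1} - (n + 2 lam) C_n`, `C_0 = 1`, `C_1 = 2 lam x`. -/
def gegenbauer (lam : ℝ) : ℕ → ℝ[X]
  | 0 => 1
  | 1 => C (2 * lam) * X
  | n + 2 => C (((n : ℝ) + 2)⁻¹) *
      (C (2 * ((n : ℝ) + 1 + lam)) * X * gegenbauer lam (n + 1)
        - C ((n : ℝ) + 2 * lam) * gegenbauer lam n)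

/-- `C_k = C_k^{(3/2)}` for an integer index, with the usual convention `C_k = 0` for `k < 0`
(needed only for `C_{n-2}` with `n = 1`). -/
def gegC : ℤ → ℝ[X]
  | Int.ofNat n => gegenbauer (3 / 2) n
  | Int.negSucc _ => 0

/-- `R_n = C_n + δ C_{n-1}`. -/
def polyR (n : ℕ) (δ : ℝ) : ℝ[X] :=
  gegC (n : ℤ) + C δ * gegC ((n : ℤ) - 1)

/-- `S_n = (2 n + 1 + δ x n) C_{n-1} - (n + 1) x C_{n-2}`. -/
def polyS (n : ℕ) (δ : ℝ) : ℝ[X] :=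
  (C (2 * (n : ℝ) + 1) + C (δ * n) * X) * gegC ((n : ℤ) - 1)
    - C ((n : ℝ) + 1) * X * gegC ((n : ℤ) - 2)

/-- `A = 2 (n + 1) (2 n + 1)`. -/
def constA (n : ℕ) : ℝ := 2 * ((n : ℝ) + 1) * (2 * (n : ℝ) + 1)

/-- The nodes in the reference interval `[-1, 1]`: the set of real roots of `R_n`. -/
def nodes (n : ℕ) (δ : ℝ) : Finset ℝ := (polyR n δ).roots.toFinset

/-- The weight `A / (R_n'(x) S_n(x))` of the node `x`. -/
def weight (n : ℕ) (δ x : ℝ) : ℝ :=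
  constA n / ((derivative (polyR n δ)).eval x * (polyS n δ).eval x)

/-- The rule on the reference interval `[-1, 1]`, as the set of its pairs (node, weight). -/
def rule (n : ℕ) (δ : ℝ) : Finset (ℝ × ℝ) := (nodes n δ).image fun x => (x, weight n δ x)

/-- A pair (node, weight) of a rule for `[-1, 1]`, transported to the interval
`[a + k h, a + (k + 1) h]` by the increasing affine map; the weight is multiplied by `h / 2`. -/
def transport (a h : ℝ) (k : ℤ) (q : ℝ × ℝ) : ℝ × ℝ :=
  (a + k * h + h / 2 * (1 + q.1), h / 2 * q.2)

/-- The rule repeated on every interval `[a + k h, a + (k + 1) h]`, `k ∈ ℤ`, as a set of pairs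
(node, weight). -/
def lineRule (a h : ℝ) (Q : Finset (ℝ × ℝ)) : Set (ℝ × ℝ) :=
  {q | ∃ k : ℤ, ∃ p ∈ Q, q = transport a h k p}

/-- The set of break points `a + k h`, `k ∈ ℤ`. -/
def breakPoints (a h : ℝ) : Set ℝ := Set.range fun k : ℤ => a + k * h

/-- `f` is a `C^0` spline of degree `D` on the real line with break points `a + k h`, `k ∈ ℤ`. -/
def IsC0Spline (D : ℕ) (a h : ℝ) (f : ℝ → ℝ) : Prop :=
  Continuous f ∧ ∀ k : ℤ, ∃ p : ℝ[X], p.natDegree ≤ D ∧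
    ∀ x ∈ Set.Icc (a + k * h) (a + (k + 1) * h), f x = p.eval x

/-- The reflection `x ↦ c - x` of the line, acting on pairs (node, weight). -/
def reflect (c : ℝ) (q : ℝ × ℝ) : ℝ × ℝ := (c - q.1, q.2)

end SplineQuadrature

end

/-!
Write `d_k = C_{k-1}^{(3/2)}`, which is the derivative of the Legendre polynomial of degree `k`, and
let `J p` be the integral of `p` over `[-1, 1]`.  A rule on `[-1, 1]` is exact for continuous splines
on the line when it is repeated, provided that it satisfies
`J p = ∑ w_i p(x_i) + γ (p(1) - p(-1))` with some constant `γ` for all `p` of degree at most `2n`: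
the end point terms of neighbouring intervals cancel, and `L¹` bounds for polynomials make all series
converge absolutely (`hasSum_transport`).

Such an identity holds with interpolatory weights if the functional `p ↦ J p - γ (p(1) - p(-1))`
annihilates `R_n q` for all `q` of degree at most `n`.  If `q` is a multiple of `1 - x²`, this follows
from the orthogonality of the `d_k` for the weight `1 - x²`
(`integralFunctional_weight_mul_of_degree_lt`).  Two conditions are left, for `q = 1` and `q = x`; they
can be solved for `γ` exactly if `n δ² = n + 2` (`endpointFunctional_polyR_mul`).

The polynomial `R_n` has at least `n - 1` sign changes in `(-1, 1)` since it is orthogonal to all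
polynomials of degree at most `n - 2`, and its signs at `±1` give their number the parity of `n`
(`exists_polyR_eq_nodal`).  Applying the rule to `(1 - x²) d_n ∏_{j ≠ i} (x - x_j)`, whose integral is
known by orthogonality, gives the weights (`endpointFunctional_basis_mul`), because
`S_n = (2n + 1) (1 - x²) d_n + n x R_n`.  It also shows that `d_n` does not vanish at the nodes.  If
`x` and `-x` were both nodes, then `d_{n+1} ± δ d_n` would both vanish at `x`, hence so would `d_n`;
this excludes a reflection symmetry.
-/

noncomputable section

open Polynomial

namespace SplineQuadrature

/-! ### The polynomials `C_k^{(3/2)}` -/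

/-- `legendreDeriv k` is `C_{k-1}^{(3/2)}`, which is the derivative of the `k`-th Legendre polynomial.
With this shift of the index the three-term recurrence starts from `0, 1`. -/
def legendreDeriv : ℕ → ℝ[X]
  | 0 => 0
  | k + 1 => gegenbauer (3 / 2) k

local notation "d" => legendreDeriv

lemma gegC_sub_one (k : ℕ) : gegC ((k : ℤ) - 1) = d k := by
  cases k with
  | zero => rfl
  | succ k =>
    have : ((k + 1 : ℕ) : ℤ) - 1 = Int.ofNat k := by simp
    rw [this]; rfl

lemma legendreDeriv_zero : d 0 = 0 := rfl

lemma legendreDeriv_one : d 1 = 1 := rfl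

lemma legendreDeriv_recurrence (k : ℕ) :
    ((k : ℝ[X]) + 1) * d (k + 2) = (2 * (k : ℝ[X]) + 3) * X * d (k + 1) - ((k : ℝ[X]) + 2) * d k := by
  cases k with
  | zero =>
    simp only [legendreDeriv, gegenbauer]
    norm_num
    rfl
  | succ k =>
    have h : ((k : ℝ) + 2) ≠ 0 := by positivity
    have h1 : C ((k : ℝ) + 2) * C (((k : ℝ) + 2)⁻¹) = 1 := by
      rw [← C_mul, mul_inv_cancel₀ h, C_1]
    have h2 : ((k + 1 : ℕ) : ℝ[X]) + 1 = C ((k : ℝ) + 2) := by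
      push_cast; simp only [map_add, map_natCast, map_ofNat]; ring
    have h3 : (2 * ((k + 1 : ℕ) : ℝ[X]) + 3) = C (2 * ((k : ℝ) + 1 + 3 / 2)) := by
      have : 2 * ((k : ℝ) + 1 + 3 / 2) = 2 * k + 5 := by ring
      rw [this]; push_cast; simp only [map_add, map_mul, map_natCast, map_ofNat]; ring
    have h4 : ((k + 1 : ℕ) : ℝ[X]) + 2 = C ((k : ℝ) + 2 * (3 / 2)) := by
      have : (k : ℝ) + 2 * (3 / 2) = k + 3 := by ring
      rw [this]; push_cast; simp only [map_add, map_natCast, map_ofNat]; ring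
    rw [h2, h3, h4]
    simp only [legendreDeriv, gegenbauer]
    rw [← mul_assoc, h1, one_mul]

lemma C_natCast_add_ofNat (k m : ℕ) [m.AtLeastTwo] :
    C ((k : ℝ) + OfNat.ofNat m) = (k : ℝ[X]) + OfNat.ofNat m := by
  rw [C_add, map_natCast, map_ofNat]

lemma C_two_mul_natCast_add_three (k : ℕ) : C (2 * (k : ℝ) + 3) = 2 * (k : ℝ[X]) + 3 := by
  rw [C_add, C_mul, map_natCast, map_ofNat, map_ofNat]

lemma C_natCast_add_one (k : ℕ) : C ((k : ℝ) + 1) = (k : ℝ[X]) + 1 := by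
  rw [C_add, map_natCast, C_1]

/-- The three-term recurrence with its coefficients written as constant polynomials. -/
lemma legendreDeriv_recurrence_C (k : ℕ) :
    C ((k : ℝ) + 1) * d (k + 2) = C (2 * (k : ℝ) + 3) * (X * d (k + 1)) - C ((k : ℝ) + 2) * d k := by
  rw [C_natCast_add_one, C_two_mul_natCast_add_three, C_natCast_add_ofNat,
    legendreDeriv_recurrence, mul_assoc]

lemma natCast_add_one_ne_zero_poly (k : ℕ) : (k : ℝ[X]) + 1 ≠ 0 := by
  exact_mod_cast Nat.succ_ne_zero k

/-- Both formulas are proved together, since the step for the first one uses the second. -/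
lemma one_sub_sq_mul_derivative_aux (k : ℕ) :
    (1 - X ^ 2) * derivative (d (k + 1)) = -(k : ℝ[X]) * X * d (k + 1) + ((k : ℝ[X]) + 2) * d k ∧
    (1 - X ^ 2) * derivative (d k) = ((k : ℝ[X]) + 2) * X * d k - (k : ℝ[X]) * d (k + 1) := by
  induction k with
  | zero => simp [legendreDeriv_zero, legendreDeriv_one]
  | succ k ih =>
    obtain ⟨h1, h2⟩ := ih
    have hr := legendreDeriv_recurrence k
    have hd := congrArg derivative hr
    simp only [derivative_mul, derivative_sub, derivative_add, derivative_natCast, derivative_one,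
      derivative_ofNat, derivative_X, zero_add, zero_mul, mul_one, mul_zero, add_zero] at hd
    push_cast
    refine ⟨mul_left_cancel₀ (natCast_add_one_ne_zero_poly k) ?_, ?_⟩
    · linear_combination (1 - X ^ 2) * hd + (2 * (k : ℝ[X]) + 3) * X * h1 - ((k : ℝ[X]) + 2) * h2
        + ((k : ℝ[X]) + 1) * X * hr
    · linear_combination h1 + hr

lemma one_sub_sq_mul_derivative_succ (k : ℕ) :
    (1 - X ^ 2) * derivative (d (k + 1)) = -(k : ℝ[X]) * X * d (k + 1) + ((k : ℝ[X]) + 2) * d k :=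
  (one_sub_sq_mul_derivative_aux k).1

lemma one_sub_sq_mul_derivative (k : ℕ) :
    (1 - X ^ 2) * derivative (d k) = ((k : ℝ[X]) + 2) * X * d k - (k : ℝ[X]) * d (k + 1) :=
  (one_sub_sq_mul_derivative_aux k).2

lemma one_sub_sq_ne_zero : (1 - X ^ 2 : ℝ[X]) ≠ 0 := fun h => by
  simpa using congrArg (eval 0) h

lemma derivative_legendreDeriv_sub (k : ℕ) :
    derivative (d (k + 2) - d k) = (2 * (k : ℝ[X]) + 3) * d (k + 1) := by
  apply mul_left_cancel₀ one_sub_sq_ne_zero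
  have h1 := one_sub_sq_mul_derivative_succ (k + 1)
  have h2 := one_sub_sq_mul_derivative k
  have hr := legendreDeriv_recurrence k
  push_cast at h1
  rw [derivative_sub]
  linear_combination h1 - h2 - X * hr

/-- The differential equation of `C_k^{(3/2)}` in self-adjoint form. -/
lemma derivative_one_sub_sq_sq_mul (k : ℕ) :
    derivative ((1 - X ^ 2) ^ 2 * derivative (d (k + 1))) =
      -((k : ℝ[X]) * ((k : ℝ[X]) + 3)) * ((1 - X ^ 2) * d (k + 1)) := by
  have h1 := one_sub_sq_mul_derivative_succ k
  have h2 := one_sub_sq_mul_derivative k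
  have e : (1 - X ^ 2) ^ 2 * derivative (d (k + 1)) =
      (1 - X ^ 2) * (-(k : ℝ[X]) * X * d (k + 1) + ((k : ℝ[X]) + 2) * d k) := by rw [← h1]; ring
  rw [e]
  simp only [derivative_mul, derivative_sub, derivative_add, derivative_natCast, derivative_one,
      derivative_ofNat, derivative_X, derivative_X_pow, derivative_neg,
      zero_add, zero_mul, mul_one, add_zero]
  have h3 : C ((2 : ℕ) : ℝ) = (2 : ℝ[X]) := by simp [map_ofNat C]
  rw [h3]
  linear_combination -(k : ℝ[X]) * X * h1 + ((k : ℝ[X]) + 2) * h2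

lemma eval_one_legendreDeriv_aux (k : ℕ) :
    (d k).eval 1 = k * (k + 1) / 2 ∧ (d (k + 1)).eval 1 = (k + 1) * (k + 2) / 2 := by
  induction k with
  | zero => simp [legendreDeriv_zero, legendreDeriv_one]
  | succ k ih =>
    obtain ⟨h1, h2⟩ := ih
    refine ⟨by rw [h2]; push_cast; ring, ?_⟩
    have hr := congrArg (eval 1) (legendreDeriv_recurrence k)
    simp only [eval_mul, eval_add, eval_sub, eval_natCast, eval_one, eval_ofNat, eval_X] at hr
    rw [h1, h2] at hr
    have : (k : ℝ) + 1 ≠ 0 := by positivity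
    apply mul_left_cancel₀ this
    push_cast
    linear_combination hr

lemma eval_one_legendreDeriv (k : ℕ) : (d k).eval 1 = k * (k + 1) / 2 :=
  (eval_one_legendreDeriv_aux k).1

lemma legendreDeriv_comp_neg_aux (k : ℕ) :
    (d k).comp (-X) = (-1) ^ (k + 1) * d k ∧ (d (k + 1)).comp (-X) = (-1) ^ k * d (k + 1) := by
  induction k with
  | zero => simp [legendreDeriv_zero, legendreDeriv_one]
  | succ k ih =>
    obtain ⟨h1, h2⟩ := ih
    refine ⟨by rw [h2]; ring, ?_⟩
    have hr := legendreDeriv_recurrence k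
    have hc := congrArg (fun p : ℝ[X] => p.comp (-X)) hr
    simp only [mul_comp, add_comp, sub_comp, natCast_comp, one_comp, ofNat_comp, X_comp] at hc
    rw [h1, h2] at hc
    apply mul_left_cancel₀ (natCast_add_one_ne_zero_poly k)
    linear_combination hc - (-1) ^ (k + 1) * hr

lemma legendreDeriv_comp_neg (k : ℕ) : (d k).comp (-X) = (-1) ^ (k + 1) * d k :=
  (legendreDeriv_comp_neg_aux k).1

lemma eval_neg_legendreDeriv (k : ℕ) (x : ℝ) :
    (d k).eval (-x) = (-1) ^ (k + 1) * (d k).eval x := by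
  have := congrArg (eval x) (legendreDeriv_comp_neg k)
  simpa [eval_comp] using this

lemma legendreDeriv_degree_aux (k : ℕ) :
    (d k).natDegree ≤ k - 1 ∧ (d (k + 1)).natDegree ≤ k ∧ 0 < (d (k + 1)).coeff k ∧
      ((k : ℝ) + 1) * (d (k + 2)).coeff (k + 1) = (2 * k + 3) * (d (k + 1)).coeff k := by
  have key : ∀ k : ℕ, (d k).natDegree ≤ k - 1 →
      ((k : ℝ) + 1) * (d (k + 2)).coeff (k + 1) = (2 * k + 3) * (d (k + 1)).coeff k := by
    intro k hk
    have hr := congrArg (fun p : ℝ[X] => p.coeff (k + 1)) (legendreDeriv_recurrence_C k)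
    simp only [coeff_C_mul, coeff_sub, coeff_X_mul] at hr
    rw [coeff_eq_zero_of_natDegree_lt (p := d k) (by omega)] at hr
    linarith
  induction k with
  | zero => refine ⟨?_, ?_, ?_, key 0 ?_⟩ <;> simp [legendreDeriv_zero, legendreDeriv_one]
  | succ k ih =>
    obtain ⟨h1, h2, h3, h4⟩ := ih
    refine ⟨h2, ?_, ?_, key _ h2⟩
    · have hk : (k : ℝ) + 1 ≠ 0 := by positivity
      have : (d (k + 1 + 1)).natDegree = (C ((k : ℝ) + 1) * d (k + 2)).natDegree := by
        rw [natDegree_C_mul hk]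
      rw [this, legendreDeriv_recurrence_C]
      refine (natDegree_sub_le _ _).trans (max_le ?_ ?_)
      · refine (natDegree_C_mul_le _ _).trans (natDegree_mul_le.trans ?_)
        rw [natDegree_X]; omega
      · exact (natDegree_C_mul_le _ _).trans (by omega)
    · have hk : (0 : ℝ) < (k : ℝ) + 1 := by positivity
      have : 0 < ((k : ℝ) + 1) * (d (k + 2)).coeff (k + 1) := by rw [h4]; positivity
      exact pos_of_mul_pos_right this hk.le

lemma natDegree_legendreDeriv_le (k : ℕ) : (d k).natDegree ≤ k - 1 :=
  (legendreDeriv_degree_aux k).1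

lemma coeff_legendreDeriv_pos (k : ℕ) : 0 < (d (k + 1)).coeff k :=
  (legendreDeriv_degree_aux k).2.2.1

lemma coeff_legendreDeriv_succ (k : ℕ) :
    ((k : ℝ) + 1) * (d (k + 2)).coeff (k + 1) = (2 * k + 3) * (d (k + 1)).coeff k :=
  (legendreDeriv_degree_aux k).2.2.2

/-! ### Orthogonality -/

/-- The integral over `[-1, 1]` as a linear functional on polynomials. -/
def integralFunctional : ℝ[X] →ₗ[ℝ] ℝ where
  toFun p := ∫ x in (-1 : ℝ)..1, p.eval x
  map_add' p q := by
    simp only [eval_add]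
    exact intervalIntegral.integral_add (p.continuous.intervalIntegrable _ _)
      (q.continuous.intervalIntegrable _ _)
  map_smul' c p := by simp [intervalIntegral.integral_const_mul]

local notation "J" => integralFunctional

lemma integralFunctional_apply (p : ℝ[X]) : J p = ∫ x in (-1 : ℝ)..1, p.eval x := rfl

lemma integralFunctional_C_mul (c : ℝ) (p : ℝ[X]) : J (C c * p) = c * J p := by
  rw [← smul_eq_C_mul, map_smul, smul_eq_mul]

lemma integralFunctional_derivative (p : ℝ[X]) : J (derivative p) = p.eval 1 - p.eval (-1) :=
  intervalIntegral.integral_eq_sub_of_hasDerivAt (fun x _ => p.hasDerivAt x)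
    ((derivative p).continuous.intervalIntegrable _ _)

lemma eq_zero_of_integralFunctional_eq_zero {p : ℝ[X]} (h : ∀ x ∈ Set.Icc (-1 : ℝ) 1, 0 ≤ p.eval x)
    (h0 : J p = 0) : p = 0 := by
  rw [integralFunctional_apply] at h0
  by_contra hp
  obtain ⟨y, hy, hy0⟩ : ∃ y ∈ Set.Icc (-1 : ℝ) 1, y ∉ p.rootSet ℝ := by
    by_contra! hc
    exact (Set.Icc_infinite (by norm_num : (-1 : ℝ) < 1)) ((rootSet_finite p ℝ).subset hc)
  have hy1 : p.eval y ≠ 0 := fun hz => hy0 ((mem_rootSet_of_ne hp).2 (by simpa using hz))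
  have := intervalIntegral.integral_pos (by norm_num : (-1 : ℝ) < 1) p.continuous.continuousOn
    (fun x hx => h x (Set.Ioc_subset_Icc_self hx)) ⟨y, hy, lt_of_le_of_ne (h y hy) hy1.symm⟩
  exact this.ne' h0

lemma integralFunctional_legendreDeriv (k : ℕ) : J (d (k + 1)) = 1 + (-1) ^ k := by
  have h := integralFunctional_derivative (d (k + 2) - d k)
  rw [derivative_legendreDeriv_sub, ← C_two_mul_natCast_add_three, integralFunctional_C_mul] at h
  simp only [eval_sub, eval_neg_legendreDeriv, eval_one_legendreDeriv] at h
  have : (2 * (k : ℝ) + 3) ≠ 0 := by positivity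
  apply mul_left_cancel₀ this
  rw [h]; push_cast; ring

lemma integralFunctional_X_mul_legendreDeriv (k : ℕ) : J (X * d (k + 1)) = 1 - (-1) ^ k := by
  cases k with
  | zero =>
    simp [legendreDeriv_one, integralFunctional_apply]
  | succ k =>
    have h := congrArg J (legendreDeriv_recurrence_C (k + 1))
    rw [map_sub, integralFunctional_C_mul, integralFunctional_C_mul,
      integralFunctional_C_mul, integralFunctional_legendreDeriv,
      integralFunctional_legendreDeriv] at h
    have : (2 * (k : ℝ) + 5) ≠ 0 := by positivity
    apply mul_left_cancel₀ this
    push_cast at h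
    linear_combination -h

/-- The base of the orthogonality: by the differential equation, `(1 - x²) d_{k+2}` is the derivative
of a polynomial that vanishes at both end points. -/
lemma integralFunctional_weight_mul (k : ℕ) : J ((1 - X ^ 2) * d (k + 2)) = 0 := by
  have h := integralFunctional_derivative ((1 - X ^ 2) ^ 2 * derivative (d (k + 1 + 1)))
  have c : -(((k + 1 : ℕ) : ℝ[X]) * (((k + 1 : ℕ) : ℝ[X]) + 3)) =
      C (-(((k : ℝ) + 1) * (k + 4))) := by
    rw [C_neg, C_mul, C_natCast_add_one, C_natCast_add_ofNat]; push_cast; ring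
  rw [derivative_one_sub_sq_sq_mul, c, integralFunctional_C_mul] at h
  have h0 : -(((k : ℝ) + 1) * (k + 4)) ≠ 0 := neg_ne_zero.2 (by positivity)
  apply (mul_eq_zero.1 (h.trans ?_)).resolve_left h0
  simp

lemma integralFunctional_weight_mul_X_pow_succ (k j : ℕ) :
    (2 * (k : ℝ) + 3) * J ((1 - X ^ 2) * d (k + 1) * X ^ (j + 1)) =
      (k + 1) * J ((1 - X ^ 2) * d (k + 2) * X ^ j) + (k + 2) * J ((1 - X ^ 2) * d k * X ^ j) := by
  have hr := legendreDeriv_recurrence_C k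
  rw [← integralFunctional_C_mul, ← integralFunctional_C_mul, ← integralFunctional_C_mul, ← map_add]
  congr 1
  linear_combination -(1 - X ^ 2) * X ^ j * hr

lemma integralFunctional_weight_mul_X_pow (j k : ℕ) (h : j < k) :
    J ((1 - X ^ 2) * d (k + 1) * X ^ j) = 0 := by
  induction j generalizing k with
  | zero =>
    obtain ⟨k, rfl⟩ := Nat.exists_eq_add_of_lt h
    simpa [add_assoc] using integralFunctional_weight_mul k
  | succ j ih =>
    obtain ⟨k, rfl⟩ : ∃ i, k = i + 1 := ⟨k - 1, by omega⟩
    have h1 := integralFunctional_weight_mul_X_pow_succ (k + 1) j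
    rw [ih (k + 1 + 1) (by omega), ih k (by omega)] at h1
    have : (2 * ((k + 1 : ℕ) : ℝ) + 3) ≠ 0 := by positivity
    apply (mul_eq_zero.1 (h1.trans ?_)).resolve_left this
    simp

lemma integralFunctional_weight_mul_eq_sum (p q : ℝ[X]) (m : ℕ) (hq : q.degree < m) :
    J (p * q) = ∑ j ∈ Finset.range m, q.coeff j * J (p * X ^ j) := by
  rcases eq_or_ne q 0 with rfl | hq0
  · simp
  conv_lhs => rw [q.as_sum_range' m ((natDegree_lt_iff_degree_lt hq0).2 hq)]
  rw [Finset.mul_sum, map_sum]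
  refine Finset.sum_congr rfl fun j _ => ?_
  rw [← integralFunctional_C_mul, ← C_mul_X_pow_eq_monomial]
  congr 1; ring

/-- Orthogonality of `d_{k+1}` for the weight `1 - x²` to all polynomials of smaller degree. -/
lemma integralFunctional_weight_mul_of_degree_lt (k : ℕ) (q : ℝ[X]) (hq : q.degree < k) :
    J ((1 - X ^ 2) * d (k + 1) * q) = 0 := by
  rw [integralFunctional_weight_mul_eq_sum _ q k hq]
  refine Finset.sum_eq_zero fun j hj => ?_
  rw [integralFunctional_weight_mul_X_pow j k (Finset.mem_range.1 hj), mul_zero]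

lemma coeff_mul_integralFunctional (k : ℕ) :
    (d (k + 2)).coeff (k + 1) * J ((1 - X ^ 2) * d (k + 1) * X ^ k) = 2 * (k + 2) := by
  induction k with
  | zero =>
    have h := coeff_legendreDeriv_succ 0
    simp only [zero_add, legendreDeriv_one] at h ⊢
    simp at h
    rw [h]
    simp [integralFunctional_apply]
    norm_num
  | succ k ih =>
    have h := coeff_legendreDeriv_succ (k + 1)
    have h1 := integralFunctional_weight_mul_X_pow_succ (k + 1) k
    rw [integralFunctional_weight_mul_X_pow _ _ (by omega : k < k + 1 + 1)] at h1
    have h2 : (2 * ((k + 1 : ℕ) : ℝ) + 3) ≠ 0 := by positivity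
    have h3 : ((k + 1 : ℕ) : ℝ) + 1 ≠ 0 := by positivity
    apply mul_left_cancel₀ h2
    apply mul_left_cancel₀ h3
    push_cast at *
    set I := J ((1 - X ^ 2) * d (k + 1 + 1) * X ^ (k + 1))
    set I' := J ((1 - X ^ 2) * d (k + 1) * X ^ k)
    linear_combination (2 * ((k : ℝ) + 1) + 3) * I * h +
      (2 * ((k : ℝ) + 1) + 3) * (d (k + 2)).coeff (k + 1) * h1 +
      (2 * ((k : ℝ) + 1) + 3) * (k + 3) * ih

/-- The integral against a monic polynomial of degree `k`; it is what makes the weights explicit. -/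
lemma coeff_mul_integralFunctional_of_monic (k : ℕ) (q : ℝ[X]) (hq : q.Monic)
    (hk : q.natDegree = k) :
    (d (k + 2)).coeff (k + 1) * J ((1 - X ^ 2) * d (k + 1) * q) = 2 * (k + 2) := by
  have h1 : J ((1 - X ^ 2) * d (k + 1) * q) = J ((1 - X ^ 2) * d (k + 1) * X ^ k) := by
    rw [← sub_eq_zero, ← map_sub, ← mul_sub]
    apply integralFunctional_weight_mul_of_degree_lt
    have hd : q.degree = k := by rw [degree_eq_natDegree hq.ne_zero, hk]
    rw [← hd]
    exact degree_sub_lt_left (by rw [hd, degree_X_pow]) hq.ne_zero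
      (by rw [hq.leadingCoeff, leadingCoeff_X_pow])
  rw [h1, coeff_mul_integralFunctional]

/-! ### The zeros of `R_n` -/

/-- A real polynomial without a zero strictly between `a` and `b` does not change sign on `[a, b]`. -/
lemma nonneg_or_nonpos_of_eval_ne_zero {a b : ℝ} (p : ℝ[X])
    (h : ∀ x ∈ Set.Ioo a b, p.eval x ≠ 0) :
    (∀ x ∈ Set.Icc a b, 0 ≤ p.eval x) ∨ (∀ x ∈ Set.Icc a b, p.eval x ≤ 0) := by
  by_contra! hc
  obtain ⟨⟨x, hx, hx0⟩, ⟨y, hy, hy0⟩⟩ := hc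
  obtain ⟨z, hz, hz0⟩ := intermediate_value_uIcc (a := x) (b := y) p.continuous.continuousOn
    (Set.mem_uIcc_of_le hx0.le hy0.le)
  have hzx : z ≠ x := by rintro rfl; exact hx0.ne hz0
  have hzy : z ≠ y := by rintro rfl; exact hy0.ne' hz0
  refine h z ⟨?_, ?_⟩ hz0
  · rcases Set.mem_uIcc.1 hz with hz | hz
    · exact hx.1.trans_lt (lt_of_le_of_ne hz.1 hzx.symm)
    · exact hy.1.trans_lt (lt_of_le_of_ne hz.1 hzy.symm)
  · rcases Set.mem_uIcc.1 hz with hz | hz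
    · exact (lt_of_le_of_ne hz.2 hzy).trans_le hy.2
    · exact (lt_of_le_of_ne hz.2 hzx).trans_le hx.2

/-- The finset `Z` collects the zeros of odd multiplicity strictly between `a` and `b`. -/
lemma exists_nodal_dvd_mul_nonneg_or_nonpos (a b : ℝ) (p : ℝ[X]) (hp : p ≠ 0) :
    ∃ Z : Finset ℝ, (∀ z ∈ Z, z ∈ Set.Ioo a b) ∧ Lagrange.nodal Z id ∣ p ∧
      ((∀ x ∈ Set.Icc a b, 0 ≤ (p * Lagrange.nodal Z id).eval x) ∨
        (∀ x ∈ Set.Icc a b, (p * Lagrange.nodal Z id).eval x ≤ 0)) := by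
  induction hn : p.natDegree using Nat.strong_induction_on generalizing p with
  | _ n ih =>
  by_cases h : ∀ x ∈ Set.Ioo a b, p.eval x ≠ 0
  · exact ⟨∅, by simp, by simp, by simpa using nonneg_or_nonpos_of_eval_ne_zero p h⟩
  push Not at h
  obtain ⟨z, hz, hz0⟩ := h
  obtain ⟨g, rfl⟩ := dvd_iff_isRoot.2 hz0
  have hg : g ≠ 0 := right_ne_zero_of_mul hp
  have hdeg : g.natDegree < n := by
    rw [natDegree_mul (X_sub_C_ne_zero z) hg, natDegree_X_sub_C] at hn; omega
  obtain ⟨Z, hZ, hdvd, hsign⟩ := ih _ hdeg g hg rfl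
  by_cases hzZ : z ∈ Z
  · -- the factor `X - z` moves from the nodal polynomial to `g`
    have e := Lagrange.nodal_eq_mul_nodal_erase (v := (id : ℝ → ℝ)) hzZ
    refine ⟨Z.erase z, fun w hw => hZ w (Finset.mem_of_mem_erase hw), ?_, ?_⟩
    · exact ((Dvd.intro_left _ e.symm).trans hdvd).mul_left _
    · have e2 : (X - C z) * g * Lagrange.nodal (Z.erase z) id = g * Lagrange.nodal Z id := by
        rw [e]; simp only [id]; ring
      rwa [e2]
  · have e := Lagrange.nodal_insert_eq_nodal (v := (id : ℝ → ℝ)) hzZ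
    refine ⟨insert z Z, ?_, ?_, ?_⟩
    · intro w hw
      rcases Finset.mem_insert.1 hw with rfl | hw
      exacts [hz, hZ w hw]
    · rw [e]; exact mul_dvd_mul_left _ hdvd
    · have e2 : (X - C z) * g * Lagrange.nodal (insert z Z) id =
          (X - C z) ^ 2 * (g * Lagrange.nodal Z id) := by
        rw [e]; simp only [id]; ring
      rw [e2]
      simp only [eval_mul (p := (X - C z) ^ 2), eval_pow]
      exact hsign.imp (fun h x hx => mul_nonneg (sq_nonneg _) (h x hx))
        (fun h x hx => mul_nonpos_of_nonneg_of_nonpos (sq_nonneg _) (h x hx))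

lemma polyR_eq (n : ℕ) (δ : ℝ) : polyR n δ = d (n + 1) + C δ * d n := by
  rw [polyR, gegC_sub_one]; rfl

/-- On the zeros of `R_n` the polynomial `S_n` agrees with `(2n + 1) (1 - x²) C_{n-1}`. -/
lemma polyS_succ_eq (m : ℕ) (δ : ℝ) :
    polyS (m + 1) δ = C (2 * ((m + 1 : ℕ) : ℝ) + 1) * ((1 - X ^ 2) * d (m + 1)) +
      C ((m + 1 : ℕ) : ℝ) * X * polyR (m + 1) δ := by
  have h : (((m + 1 : ℕ) : ℤ) - 2) = (m : ℤ) - 1 := by push_cast; ring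
  have hr := legendreDeriv_recurrence m
  rw [polyS, h, gegC_sub_one, gegC_sub_one, polyR_eq]
  simp only [C_add, C_mul, map_natCast, map_ofNat, C_1]
  push_cast
  linear_combination -X * hr

lemma natDegree_polyR_le (m : ℕ) (δ : ℝ) : (polyR (m + 1) δ).natDegree ≤ m + 1 := by
  rw [polyR_eq]
  refine (natDegree_add_le _ _).trans (max_le (natDegree_legendreDeriv_le _) ?_)
  exact (natDegree_C_mul_le _ _).trans ((natDegree_legendreDeriv_le _).trans (by omega))

lemma coeff_polyR (m : ℕ) (δ : ℝ) :
    (polyR (m + 1) δ).coeff (m + 1) = (d (m + 2)).coeff (m + 1) := by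
  have h := natDegree_legendreDeriv_le (m + 1)
  rw [polyR_eq, coeff_add, coeff_C_mul, coeff_eq_zero_of_natDegree_lt (p := d (m + 1)) (by omega),
    mul_zero, add_zero]

lemma coeff_polyR_pos (m : ℕ) (δ : ℝ) : 0 < (polyR (m + 1) δ).coeff (m + 1) := by
  rw [coeff_polyR]; exact coeff_legendreDeriv_pos _

lemma polyR_ne_zero (m : ℕ) (δ : ℝ) : polyR (m + 1) δ ≠ 0 := fun h => by
  simpa [h] using coeff_polyR_pos m δ

lemma natDegree_polyR (m : ℕ) (δ : ℝ) : (polyR (m + 1) δ).natDegree = m + 1 :=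
  natDegree_eq_of_le_of_coeff_ne_zero (natDegree_polyR_le m δ) (coeff_polyR_pos m δ).ne'

lemma eval_one_polyR (n : ℕ) (δ : ℝ) :
    (polyR n δ).eval 1 = (n + 1) / 2 * (n + 2 + δ * n) := by
  rw [polyR_eq, eval_add, eval_mul, eval_C, eval_one_legendreDeriv, eval_one_legendreDeriv]
  push_cast; ring

lemma eval_neg_polyR (n : ℕ) (δ x : ℝ) :
    (polyR n δ).eval (-x) = (-1) ^ n * (polyR n (-δ)).eval x := by
  simp only [polyR_eq, eval_add, eval_mul, eval_C, eval_neg_legendreDeriv]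
  ring

/-- `R_n` has at `1` and `-1` the signs of a polynomial with all `n` zeros between these points;
here the size of `δ` enters. -/
lemma eval_one_mul_eval_neg_one_polyR_pos {m : ℕ} {δ : ℝ} (hδ : ((m : ℝ) + 1) * δ ^ 2 = m + 3) :
    0 < (-1) ^ (m + 1) * ((polyR (m + 1) δ).eval 1 * (polyR (m + 1) δ).eval (-1)) := by
  have h1 : ((-1 : ℝ) ^ (m + 1)) * (-1) ^ (m + 1) = 1 := by
    rw [← mul_pow]; norm_num
  rw [eval_neg_polyR, eval_one_polyR, eval_one_polyR]
  push_cast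
  have : ((-1 : ℝ) ^ (m + 1)) * (((m : ℝ) + 1 + 1) / 2 * (m + 1 + 2 + δ * (m + 1)) *
      ((-1) ^ (m + 1) * ((m + 1 + 1) / 2 * (m + 1 + 2 + -δ * (m + 1))))) =
      ((m : ℝ) + 2) ^ 2 / 4 * (2 * (m + 3)) := by
    linear_combination ((m : ℝ) + 2) ^ 2 / 4 * ((m + 3) ^ 2 - δ ^ 2 * (m + 1) ^ 2) * h1 -
      ((m : ℝ) + 2) ^ 2 / 4 * (m + 1) * hδ
  rw [this]; positivity

/-- `R_n` is quasi-orthogonal for the weight `1 - x²`. -/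
lemma integralFunctional_weight_mul_polyR (m : ℕ) (δ : ℝ) (q : ℝ[X]) (hq : q.degree < m) :
    J ((1 - X ^ 2) * polyR (m + 1) δ * q) = 0 := by
  have e : (1 - X ^ 2) * polyR (m + 1) δ * q =
      (1 - X ^ 2) * d (m + 1 + 1) * q + C δ * ((1 - X ^ 2) * d (m + 1) * q) := by
    rw [polyR_eq]; ring
  rw [e, map_add, integralFunctional_C_mul, integralFunctional_weight_mul_of_degree_lt m q hq,
    integralFunctional_weight_mul_of_degree_lt (m + 1) q
      (hq.trans (by exact_mod_cast Nat.lt_succ_self m)), mul_zero, add_zero]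

/-- Quasi-orthogonality gives at least `n - 1` sign changes of `R_n` in `(-1, 1)`, and the signs at the
end points fix the parity of their number, so there are `n`. -/
lemma exists_polyR_eq_nodal {m : ℕ} {δ : ℝ} (hδ : ((m : ℝ) + 1) * δ ^ 2 = m + 3) :
    ∃ Z : Finset ℝ, (∀ z ∈ Z, z ∈ Set.Ioo (-1 : ℝ) 1) ∧ Z.card = m + 1 ∧
      polyR (m + 1) δ = C ((polyR (m + 1) δ).coeff (m + 1)) * Lagrange.nodal Z id := by
  obtain ⟨Z, hZ, hdvd, hsign⟩ := exists_nodal_dvd_mul_nonneg_or_nonpos (-1) 1 _ (polyR_ne_zero m δ)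
  have hle : Z.card ≤ m + 1 := by
    have := natDegree_le_of_dvd hdvd (polyR_ne_zero m δ)
    rwa [Lagrange.natDegree_nodal, natDegree_polyR] at this
  have hge : m ≤ Z.card := by
    by_contra! hlt
    have h0 := integralFunctional_weight_mul_polyR m δ (Lagrange.nodal Z id)
      (by rw [Lagrange.degree_nodal]; exact_mod_cast hlt)
    have hne : (1 - X ^ 2) * polyR (m + 1) δ * Lagrange.nodal Z id ≠ 0 :=
      mul_ne_zero (mul_ne_zero one_sub_sq_ne_zero (polyR_ne_zero m δ)) Lagrange.nodal_ne_zero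
    have hw : ∀ x ∈ Set.Icc (-1 : ℝ) 1, 0 ≤ (1 - X ^ 2 : ℝ[X]).eval x := by
      intro x hx
      simp only [eval_sub, eval_one, eval_pow, eval_X]
      nlinarith [hx.1, hx.2]
    rcases hsign with h | h
    · refine hne (eq_zero_of_integralFunctional_eq_zero (fun x hx => ?_) h0)
      rw [mul_assoc, eval_mul]
      exact mul_nonneg (hw x hx) (h x hx)
    · refine hne (neg_eq_zero.1 (eq_zero_of_integralFunctional_eq_zero (fun x hx => ?_)
        (by rw [map_neg, h0, neg_zero])))
      rw [eval_neg, mul_assoc, eval_mul]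
      exact neg_nonneg.2 (mul_nonpos_of_nonneg_of_nonpos (hw x hx) (h x hx))
  have hcard : Z.card = m + 1 := by
    refine le_antisymm hle (Nat.succ_le_of_lt (lt_of_le_of_ne hge fun hm => ?_))
    -- with `m` sign changes the signs at the end points would have the wrong parity
    have hpos := eval_one_mul_eval_neg_one_polyR_pos hδ
    have h1 : 0 < (Lagrange.nodal Z id).eval (1 : ℝ) := by
      rw [Lagrange.eval_nodal]
      exact Finset.prod_pos fun z hz => sub_pos.2 (hZ z hz).2
    have h2 : 0 < (-1) ^ m * (Lagrange.nodal Z id).eval (-1 : ℝ) := by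
      rw [Lagrange.eval_nodal, hm, ← Finset.prod_const, ← Finset.prod_mul_distrib]
      refine Finset.prod_pos fun z hz => ?_
      have := (hZ z hz).1
      simp only [id]; linarith
    have h3 : 0 ≤ (polyR (m + 1) δ * Lagrange.nodal Z id).eval 1 *
        (polyR (m + 1) δ * Lagrange.nodal Z id).eval (-1) := by
      rcases hsign with h | h
      · exact mul_nonneg (h _ (by norm_num)) (h _ (by norm_num))
      · exact mul_nonneg_of_nonpos_of_nonpos (h _ (by norm_num)) (h _ (by norm_num))
    have h4 : ((-1 : ℝ) ^ m) * (-1) ^ m = 1 := by rw [← mul_pow]; norm_num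
    have h5 := mul_pos hpos (mul_pos h1 h2)
    rw [eval_mul, eval_mul] at h3
    rw [pow_succ] at h5
    have h6 : ((-1 : ℝ) ^ m * -1 * (eval 1 (polyR (m + 1) δ) * eval (-1) (polyR (m + 1) δ))) *
        (eval 1 (Lagrange.nodal Z id) * ((-1) ^ m * eval (-1) (Lagrange.nodal Z id))) =
        -(eval 1 (polyR (m + 1) δ) * eval 1 (Lagrange.nodal Z id) *
          (eval (-1) (polyR (m + 1) δ) * eval (-1) (Lagrange.nodal Z id))) := by
      linear_combination -(eval 1 (polyR (m + 1) δ) * eval 1 (Lagrange.nodal Z id) *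
          (eval (-1) (polyR (m + 1) δ) * eval (-1) (Lagrange.nodal Z id))) * h4
    rw [h6] at h5
    linarith
  refine ⟨Z, hZ, hcard, ?_⟩
  have hd : (Lagrange.nodal Z (id : ℝ → ℝ)).natDegree = m + 1 := by
    rw [Lagrange.natDegree_nodal, hcard]
  obtain ⟨g, hg⟩ := hdvd
  have hg0 : g ≠ 0 := by
    rintro rfl
    exact polyR_ne_zero m δ (by rw [hg, mul_zero])
  have hgd : g.natDegree = 0 := by
    have := congrArg natDegree hg
    rw [natDegree_mul Lagrange.nodal_ne_zero hg0, natDegree_polyR, hd] at this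
    omega
  obtain ⟨c, rfl⟩ := natDegree_eq_zero.1 hgd
  have hc : (polyR (m + 1) δ).coeff (m + 1) = c := by
    rw [hg, coeff_mul_C, ← hd, Lagrange.nodal_monic.coeff_natDegree, one_mul]
  rw [hc, hg, mul_comm]

lemma mem_nodes {m : ℕ} {δ x : ℝ} : x ∈ nodes (m + 1) δ ↔ (polyR (m + 1) δ).eval x = 0 := by
  rw [nodes, Multiset.mem_toFinset, mem_roots (polyR_ne_zero m δ), IsRoot.def]

/-- All zeros of `R_n` are simple and lie in `(-1, 1)`. -/
lemma nodes_spec {m : ℕ} {δ : ℝ} (hδ : ((m : ℝ) + 1) * δ ^ 2 = m + 3) :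
    (∀ z ∈ nodes (m + 1) δ, z ∈ Set.Ioo (-1 : ℝ) 1) ∧ (nodes (m + 1) δ).card = m + 1 ∧
      polyR (m + 1) δ =
        C ((polyR (m + 1) δ).coeff (m + 1)) * Lagrange.nodal (nodes (m + 1) δ) id := by
  obtain ⟨Z, hZ, hcard, hR⟩ := exists_polyR_eq_nodal hδ
  have : nodes (m + 1) δ = Z := by
    ext x
    rw [mem_nodes, hR, eval_mul, eval_C, mul_eq_zero, or_iff_right (coeff_polyR_pos m δ).ne',
      Lagrange.eval_nodal, Finset.prod_eq_zero_iff]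
    simp [sub_eq_zero]
  rw [this]
  exact ⟨hZ, hcard, hR⟩

/-! ### The rule on the reference interval -/

/-- The functional `p ↦ ∫_{-1}^1 p - γ (p(1) - p(-1))`. The end point terms cancel when it is summed
over the intervals of a continuous spline. -/
def endpointFunctional (γ : ℝ) : ℝ[X] →ₗ[ℝ] ℝ := J - γ • (leval 1 - leval (-1))

lemma endpointFunctional_apply (γ : ℝ) (p : ℝ[X]) :
    endpointFunctional γ p = J p - γ * (p.eval 1 - p.eval (-1)) := rfl

lemma endpointFunctional_C_mul (γ c : ℝ) (p : ℝ[X]) :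
    endpointFunctional γ (C c * p) = c * endpointFunctional γ p := by
  rw [← smul_eq_C_mul, map_smul, smul_eq_mul]

lemma ne_zero_of_mul_sq_eq {m : ℕ} {δ : ℝ} (hδ : ((m : ℝ) + 1) * δ ^ 2 = m + 3) : δ ≠ 0 := by
  rintro rfl
  have : (m : ℝ) + 3 ≠ 0 := by positivity
  exact this (by rw [← hδ]; ring)

/-- The coefficient of the end point difference, `2 / (n (n + 1) δ)`, for `n = m + 1`. -/
def endpointCoeff (m : ℕ) (δ : ℝ) : ℝ := 2 / (((m : ℝ) + 1) * (m + 2) * δ)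

lemma endpointCoeff_mul_eval_one {m : ℕ} {δ : ℝ} (hδ : ((m : ℝ) + 1) * δ ^ 2 = m + 3) :
    endpointCoeff m δ * (polyR (m + 1) δ).eval 1 = δ + 1 := by
  have hδ0 := ne_zero_of_mul_sq_eq hδ
  have h1 : (m : ℝ) + 1 ≠ 0 := by positivity
  have h2 : (m : ℝ) + 2 ≠ 0 := by positivity
  rw [endpointCoeff, eval_one_polyR]
  push_cast
  field_simp
  linear_combination -((m : ℝ) + 2) * hδ

lemma endpointCoeff_mul_eval_neg_one {m : ℕ} {δ : ℝ} (hδ : ((m : ℝ) + 1) * δ ^ 2 = m + 3) :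
    endpointCoeff m δ * (polyR (m + 1) δ).eval (-1) = (-1) ^ (m + 1) * (δ - 1) := by
  have h := endpointCoeff_mul_eval_one (m := m) (δ := -δ) (by rw [neg_sq]; exact hδ)
  have e : endpointCoeff m (-δ) = -endpointCoeff m δ := by
    rw [endpointCoeff, endpointCoeff, mul_neg, div_neg]
  rw [e] at h
  rw [eval_neg_polyR]
  linear_combination -(-1) ^ (m + 1) * h

lemma exists_eq_one_sub_sq_mul_add (m : ℕ) (q : ℝ[X]) (hq : q.natDegree ≤ m + 1) :
    ∃ (s : ℝ[X]) (α β : ℝ), s.degree < m ∧ q = (1 - X ^ 2) * s + (C α * X + C β) := by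
  have hm : (X ^ 2 - 1 : ℝ[X]).Monic := by simpa using monic_X_pow_sub_C (1 : ℝ) two_ne_zero
  have hd : (X ^ 2 - 1 : ℝ[X]).natDegree = 2 := by
    simpa using natDegree_X_pow_sub_C (n := 2) (r := (1 : ℝ))
  have hr : (q %ₘ (X ^ 2 - 1)).natDegree ≤ 1 := by
    have := natDegree_modByMonic_lt q hm (fun h => by simp [h] at hd)
    omega
  obtain ⟨α, β, hαβ⟩ := exists_eq_X_add_C_of_natDegree_le_one hr
  refine ⟨-(q /ₘ (X ^ 2 - 1)), α, β, ?_, ?_⟩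
  · rw [degree_neg]
    by_cases h2 : q.natDegree < 2
    · rw [(divByMonic_eq_zero_iff hm).2, degree_zero]
      · exact WithBot.bot_lt_coe _
      · exact degree_lt_degree (by rw [hd]; exact h2)
    · refine degree_le_natDegree.trans_lt ?_
      rw [natDegree_divByMonic q hm, hd]
      exact_mod_cast (by omega : q.natDegree - 2 < m)
  · rw [← hαβ]
    conv_lhs => rw [← modByMonic_add_div q (X ^ 2 - 1)]
    ring

/-- The functional with the right coefficient `γ` annihilates all multiples `R_n q` of degree at most
`2n`. Multiples of `1 - x²` are covered by quasi-orthogonality; the remaining two conditions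
determine `γ` and force `n δ² = n + 2`. -/
lemma endpointFunctional_polyR_mul {m : ℕ} {δ : ℝ} (hδ : ((m : ℝ) + 1) * δ ^ 2 = m + 3)
    (q : ℝ[X]) (hq : q.natDegree ≤ m + 1) :
    endpointFunctional (endpointCoeff m δ) (polyR (m + 1) δ * q) = 0 := by
  obtain ⟨s, α, β, hs, rfl⟩ := exists_eq_one_sub_sq_mul_add m q hq
  have e : polyR (m + 1) δ * ((1 - X ^ 2) * s + (C α * X + C β)) =
      (1 - X ^ 2) * polyR (m + 1) δ * s +
        (C α * (X * polyR (m + 1) δ) + C β * polyR (m + 1) δ) := by ring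
  have h1 := endpointCoeff_mul_eval_one hδ
  have h2 := endpointCoeff_mul_eval_neg_one hδ
  have hJ1 : J (polyR (m + 1) δ) = 1 + (-1) ^ (m + 1) + δ * (1 + (-1) ^ m) := by
    rw [polyR_eq, map_add, integralFunctional_C_mul, integralFunctional_legendreDeriv,
      integralFunctional_legendreDeriv]
  have hJ2 : J (X * polyR (m + 1) δ) = 1 - (-1) ^ (m + 1) + δ * (1 - (-1) ^ m) := by
    rw [polyR_eq, mul_add, mul_left_comm, map_add, integralFunctional_C_mul,
      integralFunctional_X_mul_legendreDeriv, integralFunctional_X_mul_legendreDeriv]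
  rw [e, map_add, map_add, endpointFunctional_C_mul, endpointFunctional_C_mul]
  have h3 : endpointFunctional (endpointCoeff m δ) ((1 - X ^ 2) * polyR (m + 1) δ * s) = 0 := by
    rw [endpointFunctional_apply, integralFunctional_weight_mul_polyR m δ s hs]
    simp
  have h4 : endpointFunctional (endpointCoeff m δ) (X * polyR (m + 1) δ) = 0 := by
    rw [endpointFunctional_apply, hJ2]
    simp only [eval_mul, eval_X]
    linear_combination -h1 - h2
  have h5 : endpointFunctional (endpointCoeff m δ) (polyR (m + 1) δ) = 0 := by
    rw [endpointFunctional_apply, hJ1]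
    linear_combination -h1 + h2
  rw [h3, h4, h5]; ring

/-- Exactness up to degree `2n` of interpolation at the nodes, by division by the nodal polynomial. -/
lemma endpointFunctional_eq_sum {m : ℕ} {δ : ℝ} (hδ : ((m : ℝ) + 1) * δ ^ 2 = m + 3)
    (p : ℝ[X]) (hp : p.natDegree ≤ 2 * (m + 1)) :
    endpointFunctional (endpointCoeff m δ) p = ∑ x ∈ nodes (m + 1) δ,
      endpointFunctional (endpointCoeff m δ) (Lagrange.basis (nodes (m + 1) δ) id x) *
        p.eval x := by
  obtain ⟨-, hcard, hR⟩ := nodes_spec hδ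
  set N := nodes (m + 1) δ
  set ω : ℝ[X] := Lagrange.nodal N id with hω
  have hmon : ω.Monic := Lagrange.nodal_monic
  have hωd : ω.natDegree = m + 1 := by rw [hω, Lagrange.natDegree_nodal, hcard]
  have h0 : endpointFunctional (endpointCoeff m δ) (ω * (p /ₘ ω)) = 0 := by
    have h := endpointFunctional_polyR_mul hδ (p /ₘ ω)
      (by rw [natDegree_divByMonic p hmon, hωd]; omega)
    rw [hR, mul_assoc, endpointFunctional_C_mul] at h
    exact (mul_eq_zero.1 h).resolve_left (coeff_polyR_pos m δ).ne'
  have hr : (p %ₘ ω).degree < N.card := by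
    rw [← Lagrange.degree_nodal (s := N) (v := (id : ℝ → ℝ))]
    exact degree_modByMonic_lt p hmon
  have hinj : Set.InjOn (id : ℝ → ℝ) N := Set.injOn_id _
  have hev : ∀ x ∈ N, (p %ₘ ω).eval x = p.eval x := by
    intro x hx
    conv_rhs => rw [← modByMonic_add_div p ω]
    rw [eval_add, eval_mul]
    have : ω.eval x = 0 := Lagrange.eval_nodal_at_node (v := (id : ℝ → ℝ)) hx
    rw [this, zero_mul, add_zero]
  have hi := Lagrange.eq_interpolate_of_eval_eq (fun x => p.eval x) hinj hr hev
  conv_lhs => rw [← modByMonic_add_div p ω, map_add, h0, add_zero, hi, Lagrange.interpolate_apply,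
    map_sum]
  refine Finset.sum_congr rfl fun x _ => ?_
  rw [endpointFunctional_C_mul, mul_comm]

/-- Evaluation of the interpolatory rule on `(1 - x²) C_{n-1} ∏_{y ≠ x} (X - y)`, whose integral is
known by orthogonality. -/
lemma endpointFunctional_basis_mul {m : ℕ} {δ : ℝ} (hδ : ((m : ℝ) + 1) * δ ^ 2 = m + 3) {x : ℝ}
    (hx : x ∈ nodes (m + 1) δ) :
    endpointFunctional (endpointCoeff m δ) (Lagrange.basis (nodes (m + 1) δ) id x) *
      ((derivative (polyR (m + 1) δ)).eval x * ((1 - x ^ 2) * (d (m + 1)).eval x)) =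
        2 * (m + 2) := by
  obtain ⟨-, hcard, hR⟩ := nodes_spec hδ
  set N := nodes (m + 1) δ
  set ω : ℝ[X] := Lagrange.nodal (N.erase x) id with hω
  have hωd : ω.natDegree = m := by
    rw [hω, Lagrange.natDegree_nodal, Finset.card_erase_of_mem hx, hcard]; rfl
  have hder : (derivative (polyR (m + 1) δ)).eval x =
      (d (m + 2)).coeff (m + 1) * ω.eval x := by
    have h := Lagrange.eval_nodal_derivative_eval_node_eq (v := (id : ℝ → ℝ)) hx
    rw [hR, derivative_C_mul, eval_mul, eval_C, coeff_polyR]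
    congr 1
  have hdeg : ((1 - X ^ 2) * d (m + 1) * ω).natDegree ≤ 2 * (m + 1) := by
    have h1 : (1 - X ^ 2 : ℝ[X]).natDegree ≤ 2 := by compute_degree
    have h2 := natDegree_legendreDeriv_le (m + 1)
    have h3 := natDegree_mul_le (p := (1 - X ^ 2)) (q := d (m + 1))
    have h4 := natDegree_mul_le (p := (1 - X ^ 2) * d (m + 1)) (q := ω)
    omega
  have hs := endpointFunctional_eq_sum hδ _ hdeg
  rw [Finset.sum_eq_single_of_mem x hx] at hs
  · have hm := coeff_mul_integralFunctional_of_monic m ω Lagrange.nodal_monic hωd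
    rw [endpointFunctional_apply] at hs
    simp only [eval_mul, eval_sub, eval_one, eval_pow, eval_X] at hs
    rw [hder]
    linear_combination hm - (d (m + 2)).coeff (m + 1) * hs
  · intro y hy hyx
    have : ω.eval y = 0 :=
      Lagrange.eval_nodal_at_node (v := (id : ℝ → ℝ)) (Finset.mem_erase.2 ⟨hyx, hy⟩)
    rw [eval_mul, this, mul_zero, mul_zero]

lemma eval_polyS_of_mem_nodes {m : ℕ} {δ x : ℝ} (hx : x ∈ nodes (m + 1) δ) :
    (polyS (m + 1) δ).eval x =
      (2 * ((m + 1 : ℕ) : ℝ) + 1) * ((1 - x ^ 2) * (d (m + 1)).eval x) := by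
  rw [polyS_succ_eq, eval_add, eval_mul, eval_mul (q := polyR _ _), mem_nodes.1 hx]
  simp

lemma endpointFunctional_basis_mul_eq_constA {m : ℕ} {δ : ℝ}
    (hδ : ((m : ℝ) + 1) * δ ^ 2 = m + 3) {x : ℝ} (hx : x ∈ nodes (m + 1) δ) :
    endpointFunctional (endpointCoeff m δ) (Lagrange.basis (nodes (m + 1) δ) id x) *
      ((derivative (polyR (m + 1) δ)).eval x * (polyS (m + 1) δ).eval x) = constA (m + 1) := by
  have h := endpointFunctional_basis_mul hδ hx
  rw [eval_polyS_of_mem_nodes hx, constA]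
  push_cast
  linear_combination (2 * ((m : ℝ) + 1) + 1) * h

lemma derivative_mul_polyS_ne_zero {m : ℕ} {δ : ℝ} (hδ : ((m : ℝ) + 1) * δ ^ 2 = m + 3) {x : ℝ}
    (hx : x ∈ nodes (m + 1) δ) :
    (derivative (polyR (m + 1) δ)).eval x * (polyS (m + 1) δ).eval x ≠ 0 := by
  have hA : constA (m + 1) ≠ 0 := by rw [constA]; positivity
  rw [← endpointFunctional_basis_mul_eq_constA hδ hx] at hA
  exact right_ne_zero_of_mul hA

/-- The rule on `[-1, 1]` is exact up to a multiple of the difference of the end point values. -/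
lemma integralFunctional_eq_sum_weight {m : ℕ} {δ : ℝ} (hδ : ((m : ℝ) + 1) * δ ^ 2 = m + 3)
    (p : ℝ[X]) (hp : p.natDegree ≤ 2 * (m + 1)) :
    J p = ∑ x ∈ nodes (m + 1) δ, weight (m + 1) δ x * p.eval x +
      endpointCoeff m δ * (p.eval 1 - p.eval (-1)) := by
  have h := endpointFunctional_eq_sum hδ p hp
  rw [endpointFunctional_apply, sub_eq_iff_eq_add] at h
  rw [h]
  congr 1
  refine Finset.sum_congr rfl fun x hx => ?_
  rw [weight, ← endpointFunctional_basis_mul_eq_constA hδ hx,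
    mul_div_cancel_right₀ _ (derivative_mul_polyS_ne_zero hδ hx)]

/-- `C_{n-1}` does not vanish at the nodes, so no node is the negative of a node. -/
lemma neg_notMem_nodes {m : ℕ} {δ : ℝ} (hδ : ((m : ℝ) + 1) * δ ^ 2 = m + 3) {x : ℝ}
    (hx : x ∈ nodes (m + 1) δ) : -x ∉ nodes (m + 1) δ := by
  intro hnx
  have hd : (d (m + 1)).eval x ≠ 0 := by
    have h := derivative_mul_polyS_ne_zero hδ hx
    rw [eval_polyS_of_mem_nodes hx] at h
    exact right_ne_zero_of_mul (right_ne_zero_of_mul (right_ne_zero_of_mul h))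
  have hδ0 := ne_zero_of_mul_sq_eq hδ
  have h1 := mem_nodes.1 hx
  have h2 := mem_nodes.1 hnx
  rw [eval_neg_polyR] at h2
  replace h2 := (mul_eq_zero.1 h2).resolve_left (pow_ne_zero _ (by norm_num))
  simp only [polyR_eq, eval_add, eval_mul, eval_C] at h1 h2
  have : δ * (d (m + 1)).eval x = 0 := by linear_combination h1 / 2 - h2 / 2
  exact (mul_ne_zero hδ0 hd) this

/-! ### The opposite sign of `δ` -/

lemma neg_mem_nodes_neg {m : ℕ} {δ x : ℝ} :
    -x ∈ nodes (m + 1) (-δ) ↔ x ∈ nodes (m + 1) δ := by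
  rw [mem_nodes, mem_nodes, eval_neg_polyR, neg_neg]
  simp

lemma weight_neg_neg (m : ℕ) (δ x : ℝ) : weight (m + 1) (-δ) (-x) = weight (m + 1) δ x := by
  have hR : (polyR (m + 1) (-δ)).comp (-X) = (-1) ^ (m + 1) * polyR (m + 1) δ := by
    simp only [polyR_eq, add_comp, mul_comp, C_comp, legendreDeriv_comp_neg, C_neg, neg_comp]
    ring
  have hR' : (derivative (polyR (m + 1) (-δ))).eval (-x) =
      (-1) ^ m * (derivative (polyR (m + 1) δ)).eval x := by
    have h := congrArg (fun p => (derivative p).eval x) hR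
    have c : ((-1 : ℝ[X]) ^ (m + 1)) = C ((-1) ^ (m + 1)) := by simp
    simp only [derivative_comp, c, derivative_C_mul, eval_mul, eval_C, eval_comp, derivative_neg,
      derivative_X, eval_neg, eval_one, eval_X] at h
    rw [pow_succ] at h
    linarith
  have hS : (polyS (m + 1) (-δ)).eval (-x) = (-1) ^ m * (polyS (m + 1) δ).eval x := by
    simp only [polyS_succ_eq, eval_add, eval_mul, eval_C, eval_X, eval_neg_polyR,
      eval_neg_legendreDeriv, eval_sub, eval_pow, eval_one, neg_neg]
    ring
  have h1 : ((-1 : ℝ) ^ m) * (-1) ^ m = 1 := by rw [← mul_pow]; norm_num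
  rw [weight, weight, hR', hS]
  congr 1
  linear_combination (derivative (polyR (m + 1) δ)).eval x * (polyS (m + 1) δ).eval x * h1

lemma rule_neg (m : ℕ) (δ : ℝ) : rule (m + 1) (-δ) = (rule (m + 1) δ).image (reflect 0) := by
  ext q
  simp only [rule, Finset.mem_image, reflect, zero_sub]
  constructor
  · rintro ⟨x, hx, rfl⟩
    refine ⟨_, ⟨-x, ?_, rfl⟩, ?_⟩
    · rwa [← neg_mem_nodes_neg, neg_neg]
    · rw [← weight_neg_neg, neg_neg]
  · rintro ⟨_, ⟨x, hx, rfl⟩, rfl⟩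
    exact ⟨-x, neg_mem_nodes_neg.2 hx, by rw [weight_neg_neg]⟩

/-! ### Splines on the real line -/

/-- On polynomials of bounded degree a point value is integration against a fixed polynomial. -/
lemma exists_integralFunctional_mul_eq_eval (D : ℕ) (x : ℝ) :
    ∃ g : ℝ[X], ∀ p : ℝ[X], p.natDegree ≤ D → J (g * p) = p.eval x := by
  let V := degreeLT ℝ (D + 1)
  let B : V →ₗ[ℝ] Module.Dual ℝ V :=
    ((LinearMap.mul ℝ ℝ[X]).compr₂ J).domRestrict₁₂ V V
  have : FiniteDimensional ℝ V := Module.Finite.equiv (degreeLTEquiv ℝ (D + 1)).symm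
  have hB : ∀ p q : V, B p q = J ((p : ℝ[X]) * q) := fun _ _ => rfl
  have hinj : Function.Injective B := by
    refine (injective_iff_map_eq_zero B).2 fun p hp => ?_
    have h : J ((p : ℝ[X]) * p) = 0 := by rw [← hB, hp]; rfl
    have := eq_zero_of_integralFunctional_eq_zero
      (fun x _ => by rw [eval_mul]; exact mul_self_nonneg _) h
    exact Subtype.ext (mul_self_eq_zero.1 this)
  obtain ⟨g, hg⟩ := (LinearMap.injective_iff_surjective_of_finrank_eq_finrank
    (Subspace.dual_finrank_eq (K := ℝ) (V := V)).symm).1 hinj ((leval x).comp V.subtype)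
  refine ⟨g, fun p hp => ?_⟩
  have hpV : p ∈ V := mem_degreeLT.2
    (degree_le_natDegree.trans_lt (by exact_mod_cast Nat.lt_succ_of_le hp))
  exact (hB g ⟨p, hpV⟩).symm.trans (LinearMap.congr_fun hg ⟨p, hpV⟩)

/-- The `L¹` norm on `[-1, 1]` controls point values of polynomials of bounded degree. -/
lemma exists_abs_eval_le_integral (D : ℕ) (x : ℝ) :
    ∃ K : ℝ, ∀ p : ℝ[X], p.natDegree ≤ D →
      |p.eval x| ≤ K * ∫ t in (-1 : ℝ)..1, |p.eval t| := by
  obtain ⟨g, hg⟩ := exists_integralFunctional_mul_eq_eval D x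
  obtain ⟨K, hK⟩ := (isCompact_Icc (a := (-1 : ℝ)) (b := 1)).exists_bound_of_continuousOn
    g.continuous.continuousOn
  refine ⟨K, fun p hp => ?_⟩
  rw [← hg p hp, integralFunctional_apply, ← intervalIntegral.integral_const_mul]
  refine (intervalIntegral.abs_integral_le_integral_abs (by norm_num)).trans ?_
  refine intervalIntegral.integral_mono_on (by norm_num)
    ((g * p).continuous.abs.intervalIntegrable _ _)
    ((continuous_const.mul p.continuous.abs).intervalIntegrable _ _) fun t ht => ?_
  rw [eval_mul, abs_mul]
  exact mul_le_mul_of_nonneg_right (hK t ht) (abs_nonneg _)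

lemma hasSum_integral_breakPoints {a h : ℝ} (hh : 0 < h) {f : ℝ → ℝ}
    (hf : MeasureTheory.Integrable f MeasureTheory.volume) :
    HasSum (fun k : ℤ => ∫ x in (a + k * h)..(a + (k + 1) * h), f x) (∫ x, f x) := by
  have h1 := MeasureTheory.hasSum_integral_iUnion (μ := MeasureTheory.volume) (f := f)
    (s := fun k : ℤ => Set.Ioc (a + k • h) (a + (k + 1) • h)) (fun _ => measurableSet_Ioc)
    (Set.pairwise_disjoint_Ioc_add_zsmul a h) hf.integrableOn
  rw [iUnion_Ioc_add_zsmul hh, MeasureTheory.setIntegral_univ] at h1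
  have e : (fun k : ℤ => ∫ x in (a + k * h)..(a + (k + 1) * h), f x) =
      fun k : ℤ => ∫ x in Set.Ioc (a + k • h) (a + (k + 1) • h), f x := by
    funext k
    simp only [zsmul_eq_mul, Int.cast_add, Int.cast_one]
    exact intervalIntegral.integral_of_le (by nlinarith)
  rwa [e]

/-- The pull-back to `[-1, 1]` of a spline piece. -/
lemma IsC0Spline.exists_eval {D : ℕ} {a h : ℝ} (hh : 0 < h) {f : ℝ → ℝ} (hf : IsC0Spline D a h f)
    (k : ℤ) : ∃ p : ℝ[X], p.natDegree ≤ D ∧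
      ∀ u ∈ Set.Icc (-1 : ℝ) 1, f (a + k * h + h / 2 * (1 + u)) = p.eval u := by
  obtain ⟨p, hp, hpf⟩ := hf.2 k
  refine ⟨p.comp (C (h / 2) * X + C (a + k * h + h / 2)), ?_, fun u hu => ?_⟩
  · refine natDegree_comp_le.trans ((Nat.mul_le_mul hp natDegree_linear_le).trans (by omega))
  · rw [hpf]
    · simp only [eval_comp, eval_add, eval_mul, eval_C, eval_X]
      congr 1; ring
    · constructor <;> nlinarith [hu.1, hu.2]

lemma integral_breakPoints_eq {a h : ℝ} (hh : 0 < h) (f : ℝ → ℝ) (k : ℤ) :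
    ∫ x in (a + k * h)..(a + (k + 1) * h), f x =
      h / 2 * ∫ u in (-1 : ℝ)..1, f (a + k * h + h / 2 * (1 + u)) := by
  have h2 : h / 2 ≠ 0 := by positivity
  have e : ∀ u : ℝ, a + k * h + h / 2 * (1 + u) = h / 2 * u + (a + k * h + h / 2) := by
    intro u; ring
  simp only [e]
  rw [intervalIntegral.integral_comp_mul_add _ h2, smul_eq_mul, mul_inv_cancel_left₀ h2]
  congr 1 <;> ring

/-- The values of an integrable spline at corresponding points of the intervals are bounded by a
multiple of its `L¹` norms on the intervals, hence summable. -/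
lemma IsC0Spline.summable_eval {D : ℕ} {a h : ℝ} (hh : 0 < h) {f : ℝ → ℝ}
    (hf : IsC0Spline D a h f) (hi : MeasureTheory.Integrable f MeasureTheory.volume) {u : ℝ}
    (hu : u ∈ Set.Icc (-1 : ℝ) 1) :
    Summable fun k : ℤ => f (a + k * h + h / 2 * (1 + u)) := by
  obtain ⟨K, hK⟩ := exists_abs_eval_le_integral D u
  have hs := (hasSum_integral_breakPoints (a := a) hh hi.abs).summable.mul_left (K * (2 / h))
  refine Summable.of_norm_bounded hs fun k => ?_
  obtain ⟨p, hp, hpf⟩ := hf.exists_eval hh k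
  rw [integral_breakPoints_eq hh, hpf u hu, Real.norm_eq_abs]
  refine (hK p hp).trans (le_of_eq ?_)
  have : ∫ t in (-1 : ℝ)..1, |f (a + k * h + h / 2 * (1 + t))| =
      ∫ t in (-1 : ℝ)..1, |p.eval t| := by
    refine intervalIntegral.integral_congr fun t ht => ?_
    rw [Set.uIcc_of_le (by norm_num)] at ht
    simp only [hpf t ht]
  rw [this]
  field_simp

lemma sum_rule {M : Type*} [AddCommMonoid M] (n : ℕ) (δ : ℝ) (g : ℝ × ℝ → M) :
    ∑ q : rule n δ, g q.1 = ∑ x ∈ nodes n δ, g (x, weight n δ x) := by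
  rw [Finset.sum_coe_sort (rule n δ) g, rule, Finset.sum_image]
  intro x _ y _ hxy
  exact congrArg Prod.fst hxy

lemma hasSum_transport {m : ℕ} {δ : ℝ} (hδ : ((m : ℝ) + 1) * δ ^ 2 = m + 3) {a h : ℝ} (hh : 0 < h)
    {f : ℝ → ℝ} (hf : IsC0Spline (2 * (m + 1)) a h f)
    (hi : MeasureTheory.Integrable f MeasureTheory.volume) :
    HasSum (fun j : ℤ × rule (m + 1) δ =>
      (transport a h j.1 j.2.1).2 * f (transport a h j.1 j.2.1).1) (∫ x, f x) := by
  have hIcc : ∀ x ∈ nodes (m + 1) δ, x ∈ Set.Icc (-1 : ℝ) 1 :=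
    fun x hx => Set.Ioo_subset_Icc_self ((nodes_spec hδ).1 x hx)
  have hmem : ∀ q : rule (m + 1) δ, q.1.1 ∈ Set.Icc (-1 : ℝ) 1 := by
    rintro ⟨q, hq⟩
    obtain ⟨x, hx, rfl⟩ := Finset.mem_image.1 hq
    exact hIcc x hx
  -- summability over all pairs
  have hsum : Summable (fun j : ℤ × rule (m + 1) δ =>
      (transport a h j.1 j.2.1).2 * f (transport a h j.1 j.2.1).1) := by
    refine Summable.of_norm ((summable_prod_of_nonneg fun _ => norm_nonneg _).2
      ⟨fun k => Summable.of_finite, ?_⟩)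
    simp only [tsum_fintype]
    exact summable_sum fun q _ => ((hf.summable_eval hh hi (hmem q)).mul_left _).norm
  -- the contribution of one interval
  have hone : ∀ k : ℤ, ∑ q : rule (m + 1) δ,
      (transport a h k q.1).2 * f (transport a h k q.1).1 =
        (∫ x in (a + k * h)..(a + (k + 1) * h), f x) - h / 2 * endpointCoeff m δ *
          (f (a + ((k + 1 : ℤ) : ℝ) * h) - f (a + k * h)) := by
    intro k
    obtain ⟨p, hp, hpf⟩ := hf.exists_eval hh k
    have hJ : ∫ u in (-1 : ℝ)..1, f (a + k * h + h / 2 * (1 + u)) = J p := by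
      refine intervalIntegral.integral_congr fun t ht => ?_
      rw [Set.uIcc_of_le (by norm_num)] at ht
      exact hpf t ht
    have e1 : f (a + ((k + 1 : ℤ) : ℝ) * h) = p.eval 1 := by
      rw [← hpf 1 (by norm_num)]; congr 1; push_cast; ring
    have e2 : f (a + k * h) = p.eval (-1) := by
      rw [← hpf (-1) (by norm_num)]; congr 1; ring
    rw [sum_rule (m + 1) δ (fun q => (transport a h k q).2 * f (transport a h k q).1),
      integral_breakPoints_eq hh, hJ, e1, e2, integralFunctional_eq_sum_weight hδ p hp, mul_add,
      Finset.mul_sum, mul_assoc (h / 2), add_sub_cancel_right]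
    refine Finset.sum_congr rfl fun x hx => ?_
    simp only [transport]
    rw [hpf x (hIcc x hx)]; ring
  -- the values at the break points are summable, so their differences sum to zero
  have hb : Summable fun k : ℤ => f (a + k * h) := by
    simpa using hf.summable_eval hh hi (u := -1) (by norm_num)
  have hb1 := ((Equiv.addRight (1 : ℤ)).hasSum_iff (f := fun k : ℤ => f (a + k * h))).2 hb.hasSum
  have htel := (hb1.sub hb.hasSum).mul_left (h / 2 * endpointCoeff m δ)
  have htot := (hasSum_integral_breakPoints (a := a) hh hi).sub htel
  rw [sub_self, mul_zero, sub_zero] at htot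
  have hfib := hsum.hasSum.prod_fiberwise fun k => hasSum_fintype _
  simp only [hone] at hfib
  rw [← hfib.unique htot]
  exact hsum.hasSum

/-! ### Absence of reflection symmetry -/

lemma image_reflect_rule_ne {m : ℕ} {δ : ℝ} (hδ : ((m : ℝ) + 1) * δ ^ 2 = m + 3) :
    (rule (m + 1) δ).image (reflect 0) ≠ rule (m + 1) δ := by
  intro heq
  obtain ⟨x, hx⟩ : (nodes (m + 1) δ).Nonempty :=
    Finset.card_pos.1 (by rw [(nodes_spec hδ).2.1]; omega)
  have h1 : reflect 0 (x, weight (m + 1) δ x) ∈ rule (m + 1) δ := by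
    rw [← heq]
    exact Finset.mem_image_of_mem _ (Finset.mem_image_of_mem _ hx)
  obtain ⟨y, hy, hyx⟩ := Finset.mem_image.1 h1
  have : y = -x := by simpa [reflect] using congrArg Prod.fst hyx
  exact neg_notMem_nodes hδ hx (this ▸ hy)

lemma image_reflect_lineRule_ne {m : ℕ} {δ : ℝ} (hδ : ((m : ℝ) + 1) * δ ^ 2 = m + 3) {a h : ℝ}
    (hh : 0 < h) {c : ℝ} (hc : (fun x => c - x) '' breakPoints a h = breakPoints a h) :
    reflect c '' lineRule a h (rule (m + 1) δ) ≠ lineRule a h (rule (m + 1) δ) := by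
  intro heq
  obtain ⟨hIoo, hcard, -⟩ := nodes_spec hδ
  obtain ⟨x, hx⟩ : (nodes (m + 1) δ).Nonempty := Finset.card_pos.1 (by rw [hcard]; omega)
  obtain ⟨l, hl⟩ : c - a ∈ breakPoints a h := by
    rw [← hc]
    exact ⟨a, ⟨0, by simp⟩, rfl⟩
  have h1 : reflect c (transport a h 0 (x, weight (m + 1) δ x)) ∈
      lineRule a h (rule (m + 1) δ) := by
    rw [← heq]
    exact Set.mem_image_of_mem _ ⟨0, _, Finset.mem_image_of_mem _ hx, rfl⟩
  obtain ⟨k, q, hq, hkq⟩ := h1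
  obtain ⟨y, hy, rfl⟩ := Finset.mem_image.1 hq
  have e := congrArg Prod.fst hkq
  simp only [reflect, transport, Int.cast_zero, zero_mul, add_zero] at e hl
  -- a node `y` and the reflected node `-x` differ by an even integer, which can only be zero
  have e2 : x + y = 2 * ((l - k - 1 : ℤ) : ℝ) := by
    push_cast
    apply mul_left_cancel₀ hh.ne'
    linear_combination -2 * e - 2 * hl
  obtain ⟨hx1, hx2⟩ := hIoo x hx
  obtain ⟨hy1, hy2⟩ := hIoo y hy
  have h0 : l - k - 1 = 0 := by
    have h3 : ((l - k - 1 : ℤ) : ℝ) < 1 := by linarith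
    have h4 : (-1 : ℝ) < ((l - k - 1 : ℤ) : ℝ) := by linarith
    have h5 : l - k - 1 < 1 := by exact_mod_cast h3
    have h6 : -1 < l - k - 1 := by exact_mod_cast h4
    omega
  rw [h0, Int.cast_zero, mul_zero] at e2
  have hyx : y = -x := by linarith
  exact neg_notMem_nodes hδ hx (hyx ▸ hy)

end SplineQuadrature

end

theorem mainTheorem2 (n : ℕ) (hn : 1 ≤ n) (δ : ℝ)
    (hδ : δ = Real.sqrt (((n : ℝ) + 2) / n) ∨ δ = -Real.sqrt (((n : ℝ) + 2) / n)) :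
    -- `R_n` has degree `n` and `n` distinct real roots, all in `(-1, 1)`
    ((SplineQuadrature.polyR n δ).natDegree = n ∧
      (SplineQuadrature.nodes n δ).card = n ∧
      ∀ x ∈ SplineQuadrature.nodes n δ, x ∈ Set.Ioo (-1 : ℝ) 1) ∧
    -- the weights are well defined
    (∀ x ∈ SplineQuadrature.nodes n δ,
      (Polynomial.derivative (SplineQuadrature.polyR n δ)).eval x *
        (SplineQuadrature.polyS n δ).eval x ≠ 0) ∧
    -- the repeated rule is exact for the splines of class `C^0` and degree `2 n` on the real line
    (∀ a h : ℝ, 0 < h → ∀ f : ℝ → ℝ, SplineQuadrature.IsC0Spline (2 * n) a h f →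
      MeasureTheory.Integrable f MeasureTheory.volume →
      HasSum (fun j : ℤ × SplineQuadrature.rule n δ =>
          (SplineQuadrature.transport a h j.1 j.2.1).2 *
            f (SplineQuadrature.transport a h j.1 j.2.1).1)
        (∫ x, f x)) ∧
    -- no reflection symmetry, neither of the rule on `[-1, 1]` nor of the repeated rule
    ((SplineQuadrature.rule n δ).image (SplineQuadrature.reflect 0) ≠
        SplineQuadrature.rule n δ ∧
      ∀ a h : ℝ, 0 < h → ∀ c : ℝ,
        (fun x => c - x) '' SplineQuadrature.breakPoints a h =
            SplineQuadrature.breakPoints a h →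
        SplineQuadrature.reflect c '' SplineQuadrature.lineRule a h (SplineQuadrature.rule n δ) ≠
          SplineQuadrature.lineRule a h (SplineQuadrature.rule n δ)) ∧
    -- the opposite sign gives the mirror image
    SplineQuadrature.rule n (-δ) =
      (SplineQuadrature.rule n δ).image (SplineQuadrature.reflect 0) := by
  obtain ⟨m, rfl⟩ : ∃ m, n = m + 1 := ⟨n - 1, by omega⟩
  have hδ2 : ((m : ℝ) + 1) * δ ^ 2 = m + 3 := by
    have h1 : (m : ℝ) + 1 ≠ 0 := by positivity
    have h2 : δ ^ 2 = (((m + 1 : ℕ) : ℝ) + 2) / ((m + 1 : ℕ) : ℝ) := by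
      rcases hδ with rfl | rfl
      · exact Real.sq_sqrt (by positivity)
      · rw [neg_sq]; exact Real.sq_sqrt (by positivity)
    rw [h2]
    push_cast
    field_simp
    ring
  obtain ⟨hIoo, hcard, -⟩ := SplineQuadrature.nodes_spec hδ2
  exact ⟨⟨SplineQuadrature.natDegree_polyR m δ, hcard, hIoo⟩,
    fun x hx => SplineQuadrature.derivative_mul_polyS_ne_zero hδ2 hx,
    fun a h hh f hf hi => SplineQuadrature.hasSum_transport hδ2 hh hf hi,
    ⟨SplineQuadrature.image_reflect_rule_ne hδ2,
      fun a h hh c hc => SplineQuadrature.image_reflect_lineRule_ne hδ2 hh hc⟩,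
    SplineQuadrature.rule_neg m δ⟩
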